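/- Let $s\ge 2$ be an integer and let $X$ be a real random variable with c.d.f. $F$; for $0<p<1$ put $F^{\leftarrow}(p)=\inf\{t\in\mathbb R: F(t)\ge p\}$. Let $x=F^{\leftarrow}\left(\frac1{s+1}\right)$ and $y=F^{\leftarrow}\left(\frac s{s+1}\right)$, and assume that $y/x>0$ (i.e. $x$ and $y$ are non-zero and of the same sign, for instance $x>0$). Assume that the density $f=F'$ exists at $x$ and at $y$ with $0<f(x)<\infty$ and $0<f(y)<\infty$; $F$ need not be differentiable elsewhere. For each integer $k\ge 1$ let $n=(s+1)k-1$, and let $X_{(1,n)}\le\dots\le X_{(n,n)}$ be the increasing order statistics of $n$ independent observations on $X$. Put $$a=x f(x),\qquad b=y f(y),\qquad V=\frac1{(s+1)^2}\left(\frac s{a^2}-\frac2{ab}+\frac s{b^2}\right).$$ Then $V>0$ and, as $k\to\infty$, $$\sqrt{n}\left[\log\left(\frac{X_{(ks,n)}}{X_{(k,n)}}\right)-\log\left(\frac{F^{\leftarrow}\left(\frac s{s+1}\right)}{F^{\leftarrow}\left(\frac1{s+1}\right)}\right)\right]\ \xrightarrow{\ d\ }\ N(0,V),$$ where, on the event (of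 probability tending to $0$) that the ratio of order statistics is not positive or not defined, $\log z$ is read as $\log|z|$ for $z<0$ and as $0$ where the ratio is $0$ or has zero denominator. Moreover $p\mapsto\log|F^{\leftarrow}(p)|$ is differentiable at $\frac1{s+1}$ and at $\frac s{s+1}$, and $$a=\frac1{\left(\log|F^{\leftarrow}(p)|\right)'\big|_{p=1/(s+1)}},\qquad b=\frac1{\left(\log|F^{\leftarrow}(p)|\right)'\big|_{p=s/(s+1)}}$$ (the absolute values can be dropped if $x>0$). -/

import Mathlib

open MeasureTheory ProbabilityTheory Filter

/-- The generalized inverse `F^←(p) = inf {t : F(t) ≥ p}` of the c.d.f. `F` of the law `μ`,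
for `0 < p < 1`. -/
noncomputable def quantile (μ : Measure ℝ) (p : ℝ) : ℝ :=
  sInf {t : ℝ | p ≤ cdf μ t}

/-- The `j`-th smallest of the numbers `x 0, …, x (n - 1)`, counted with multiplicity, for
`1 ≤ j ≤ n`. The value `0` for other `j` is a mere convention. -/
noncomputable def orderStat {n : ℕ} (x : Fin n → ℝ) (j : ℕ) : ℝ :=
  if h : 1 ≤ j ∧ j ≤ n then x (Tuple.sort x ⟨j - 1, by omega⟩) else 0

/-- `V = (s / a² - 2 / (a b) + s / b²) / (s + 1)²`. -/
noncomputable def asympVariance (s : ℕ) (a b : ℝ) : ℝ :=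
  1 / ((s : ℝ) + 1) ^ 2 * ((s : ℝ) / a ^ 2 - 2 / (a * b) + (s : ℝ) / b ^ 2)

/-- `T_{k,s} = √n (log (X_(ks,n) / X_(k,n)) - log (y / x))` with `n = (s + 1) k - 1`,
as a function of the sample. -/
noncomputable def logRatioStat (s k : ℕ) (x y : ℝ) (v : Fin ((s + 1) * k - 1) → ℝ) : ℝ :=
  √(((s + 1) * k - 1 : ℕ) : ℝ) *
    (Real.log (orderStat v (k * s) / orderStat v k) - Real.log (y / x))

/-!
For a level `t`, comparing `√n (X_(j,n) - F^←(p))` with `t` amounts to comparing a normalized sum of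
indicators of `(-∞, F^←(p) + t / √n]` with `t`; since `F` is differentiable at `F^←(p)`, this sum
is asymptotically the one at `t = 0`, and Ghosh's lemma turns the family of comparisons into
Bahadur's representation of the sample quantile as `F^←(p) - (F_n(F^←(p)) - p) / f(F^←(p))` up to
`o_P(n^{-1/2})`, with `F_n` the empirical c.d.f. The delta method for `(u, v) ↦ log (v / u)` then
reduces the claim to the central limit theorem for one sequence of bounded i.i.d. variables. As only
the laws of the samples matter, the triangular array may be replaced by the initial segments of a
single i.i.d. sequence. The derivative of the quantile function at `p` comes from inverting
`F(t) - p ~ f(x) (t - x)` at `x = F^←(p)`.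
-/

open scoped Topology ENNReal

section Quantile

variable {μ : Measure ℝ} {p d t : ℝ}

theorem bddBelow_setOf_le_cdf (hp : 0 < p) : BddBelow {t : ℝ | p ≤ cdf μ t} := by
  obtain ⟨m, hm⟩ := ((tendsto_cdf_atBot μ).eventually_lt_const hp).exists
  exact ⟨m, fun u hu => le_of_not_gt fun h => (hm.trans_le hu).not_ge (monotone_cdf μ h.le)⟩

theorem nonempty_setOf_le_cdf (hp : p < 1) : {t : ℝ | p ≤ cdf μ t}.Nonempty :=
  (((tendsto_cdf_atTop μ).eventually_const_lt hp).exists).imp fun _ => le_of_lt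

theorem le_cdf_quantile (hp : p < 1) : p ≤ cdf μ (quantile μ p) := by
  have hright : Tendsto (cdf μ) (𝓝[>] quantile μ p) (𝓝 (cdf μ (quantile μ p))) :=
    ((cdf μ).right_continuous _).mono_left (nhdsWithin_mono _ Set.Ioi_subset_Ici_self)
  refine ge_of_tendsto hright ?_
  filter_upwards [self_mem_nhdsWithin] with u hu
  obtain ⟨w, hw, hwu⟩ := exists_lt_of_csInf_lt (nonempty_setOf_le_cdf hp) hu
  exact le_trans hw (monotone_cdf μ hwu.le)

theorem quantile_le_iff (hp0 : 0 < p) (hp1 : p < 1) : quantile μ p ≤ t ↔ p ≤ cdf μ t :=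
  ⟨fun h => (le_cdf_quantile hp1).trans (monotone_cdf μ h),
    fun h => csInf_le (bddBelow_setOf_le_cdf hp0) h⟩

theorem lt_quantile_iff (hp0 : 0 < p) (hp1 : p < 1) : t < quantile μ p ↔ cdf μ t < p :=
  lt_iff_lt_of_le_iff_le (quantile_le_iff hp0 hp1)

theorem cdf_quantile (hp0 : 0 < p) (hp1 : p < 1) (hc : ContinuousAt (cdf μ) (quantile μ p)) :
    cdf μ (quantile μ p) = p := by
  refine le_antisymm ?_ (le_cdf_quantile hp1)
  refine le_of_tendsto (hc.continuousWithinAt (s := Set.Iio (quantile μ p))) ?_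
  filter_upwards [self_mem_nhdsWithin] with u hu
  exact ((lt_quantile_iff hp0 hp1).1 hu).le

theorem continuousAt_quantile (hp0 : 0 < p) (hp1 : p < 1)
    (hstrict : ∀ t, quantile μ p < t → p < cdf μ t) : ContinuousAt (quantile μ) p := by
  have hmem : ∀ᶠ q in 𝓝 p, 0 < q ∧ q < 1 := (lt_mem_nhds hp0).and (gt_mem_nhds hp1)
  refine tendsto_order.2 ⟨fun u hu => ?_, fun u hu => ?_⟩
  · filter_upwards [hmem, lt_mem_nhds ((lt_quantile_iff hp0 hp1).1 hu)] with q hq huq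
    exact (lt_quantile_iff hq.1 hq.2).2 huq
  · obtain ⟨w, hw, hwu⟩ := exists_between hu
    filter_upwards [hmem, gt_mem_nhds (hstrict w hw)] with q hq hqw
    exact ((quantile_le_iff hq.1 hq.2).2 hqw.le).trans_lt hwu

theorem isLittleO_sub_sub_mul_quantile (hp0 : 0 < p) (hp1 : p < 1)
    (hF : HasDerivAt (cdf μ) d (quantile μ p)) (hQ : ContinuousAt (quantile μ) p) :
    (fun q => q - p - d * (quantile μ q - quantile μ p)) =o[𝓝 p]
      fun q => quantile μ q - quantile μ p := by
  refine Asymptotics.isLittleO_iff.2 fun c hc => ?_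
  have hlin := ((hasDerivAt_iff_isLittleO.1 hF).def hc).eventually_nhds
  rw [cdf_quantile hp0 hp1 hF.continuousAt] at hlin
  filter_upwards [hQ.eventually hlin, lt_mem_nhds hp0, gt_mem_nhds hp1] with q hq hq0 hq1
  simp only [Real.norm_eq_abs, smul_eq_mul] at hq ⊢
  set x := quantile μ p
  have hupper := (abs_le.1 hq.self_of_nhds).2
  -- `F` may jump at `F^←(q)`, but `F < q` to the left of it.
  have hlower : p + (quantile μ q - x) * d - c * |quantile μ q - x| ≤ q := by
    have hlim : ContinuousAt (fun u => p + (u - x) * d - c * |u - x|) (quantile μ q) := by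
      fun_prop
    refine le_of_tendsto (hlim.continuousWithinAt (s := Set.Iio (quantile μ q))) ?_
    filter_upwards [self_mem_nhdsWithin, nhdsWithin_le_nhds hq] with u hu hub
    linarith [(abs_le.1 hub).1, (lt_quantile_iff hq0 hq1).1 hu]
  have hle := le_cdf_quantile (μ := μ) hq1
  exact abs_le.2 ⟨by linarith, by linarith⟩

theorem lt_of_monotone_of_hasDerivAt_pos {F : ℝ → ℝ} {x : ℝ} (hmono : Monotone F) (hd : 0 < d)
    (hF : HasDerivAt F d x) (hxt : x < t) : F x < F t := by
  have hslope : ∀ᶠ u in 𝓝[>] x, 0 < slope F x u :=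
    ((hasDerivAt_iff_tendsto_slope.1 hF).mono_left (nhdsGT_le_nhdsNE x)).eventually_const_lt hd
  obtain ⟨u, hu, hxu, hut⟩ := (hslope.and (Ioo_mem_nhdsGT hxt)).exists
  rw [slope_def_field, div_pos_iff_of_pos_right (sub_pos.2 hxu), sub_pos] at hu
  exact hu.trans_le (hmono hut.le)

theorem hasDerivAt_quantile (hp0 : 0 < p) (hp1 : p < 1) (hd : 0 < d)
    (hF : HasDerivAt (cdf μ) d (quantile μ p)) : HasDerivAt (quantile μ) d⁻¹ p := by
  have hFp : cdf μ (quantile μ p) = p := cdf_quantile hp0 hp1 hF.continuousAt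
  have hQ : ContinuousAt (quantile μ) p := continuousAt_quantile hp0 hp1 fun t ht =>
    hFp.symm.trans_lt (lt_of_monotone_of_hasDerivAt_pos (monotone_cdf μ) hd hF ht)
  have hequiv : Asymptotics.IsEquivalent (𝓝 p) (fun q => q - p)
      fun q => d * (quantile μ q - quantile μ p) :=
    (isLittleO_sub_sub_mul_quantile hp0 hp1 hF hQ).trans_isBigO
      (Asymptotics.isBigO_self_const_mul hd.ne' _ _)
  refine hasDerivAt_iff_isLittleO.2
    ((hequiv.symm.isLittleO.const_mul_left d⁻¹).congr_left fun q => ?_)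
  simp only [Pi.sub_apply, smul_eq_mul]
  field_simp

theorem hasDerivAt_log_quantile (hp0 : 0 < p) (hp1 : p < 1) (hd : 0 < d)
    (hF : HasDerivAt (cdf μ) d (quantile μ p)) (h0 : quantile μ p ≠ 0) :
    HasDerivAt (fun q => Real.log (quantile μ q)) (1 / (quantile μ p * d)) p := by
  convert! (hasDerivAt_quantile hp0 hp1 hd hF).log h0 using 1
  field_simp

end Quantile

/-- The indicator function of `(-∞, t]`, whose sample average is the empirical c.d.f. at `t`. -/
noncomputable abbrev iicIndicator (t : ℝ) : ℝ → ℝ := (Set.Iic t).indicator 1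

section OrderStat

variable {n : ℕ}

theorem orderStat_le_iff {v : Fin n → ℝ} {j : ℕ} (hj : 1 ≤ j ∧ j ≤ n) {t : ℝ} :
    orderStat v j ≤ t ↔ (j : ℝ) ≤ ∑ i, iicIndicator t (v i) := by
  have hcard : ∑ i, iicIndicator t (v i) =
      ((Finset.univ.filter fun i => (v ∘ Tuple.sort v) i ≤ t).card : ℝ) := by
    rw [← Equiv.sum_comp (Tuple.sort v)]
    simp [Set.indicator_apply, Finset.sum_boole]
  rw [hcard, Nat.cast_le, orderStat, dif_pos hj]
  have hsorted := Tuple.lt_card_le_iff_apply_le_of_monotone (a := t) (j := ⟨j - 1, by omega⟩)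
    (Tuple.monotone_sort v)
  simp only [Function.comp_apply] at hsorted ⊢
  rw [← hsorted]
  omega

@[fun_prop]
theorem measurable_orderStat (j : ℕ) : Measurable fun v : Fin n → ℝ => orderStat v j := by
  by_cases hj : 1 ≤ j ∧ j ≤ n
  · refine measurable_of_Iic fun t => ?_
    simp only [Set.preimage, Set.mem_Iic, orderStat_le_iff hj]
    refine measurableSet_le measurable_const (Finset.measurable_fun_sum _ fun i _ => ?_)
    exact (measurable_one.indicator measurableSet_Iic).comp (measurable_pi_apply i)
  · simp [orderStat, hj]

theorem measurable_logRatioStat (s k : ℕ) (x y : ℝ) : Measurable (logRatioStat s k x y) := by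
  unfold logRatioStat
  fun_prop

end OrderStat

/-- The family `W` of random vectors is bounded in probability (`W = O_P(1)`) along `l`: it takes
values outside a large ball with arbitrarily small probability, eventually along `l`. -/
def BoundedInProb {ι Ω E : Type*} [MeasurableSpace Ω] [Norm E] (P : Measure Ω) (W : ι → Ω → E)
    (l : Filter ι) : Prop :=
  ∀ δ : ℝ≥0∞, 0 < δ → ∃ M : ℝ, 0 < M ∧ ∀ᶠ i in l, P {ω | M ≤ ‖W i ω‖} ≤ δ

section InProbability

variable {ι Ω E F : Type*} [MeasurableSpace Ω] {P : Measure Ω} {l : Filter ι}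
  [SeminormedAddCommGroup E] [SeminormedAddCommGroup F]

theorem tendstoInMeasure_zero_iff {V : ι → Ω → E} :
    TendstoInMeasure P V l 0 ↔
      ∀ ε : ℝ, 0 < ε → ∀ δ : ℝ≥0∞, 0 < δ → ∀ᶠ i in l, P {ω | ε ≤ ‖V i ω‖} ≤ δ := by
  simp [tendstoInMeasure_iff_norm, ENNReal.tendsto_nhds_zero]

theorem measure_le_of_subset_union {A B C : Set Ω} {δ : ℝ≥0∞} (h : A ⊆ B ∪ C) (hB : P B ≤ δ / 2)
    (hC : P C ≤ δ / 2) : P A ≤ δ :=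
  (measure_mono h).trans <|
    (measure_union_le _ _).trans <| (add_le_add hB hC).trans_eq (ENNReal.add_halves δ)

theorem tendstoInMeasure_zero_of_tendsto {c : ι → E} (hc : Tendsto c l (𝓝 0)) :
    TendstoInMeasure P (fun i _ => c i) l 0 := by
  refine tendstoInMeasure_zero_iff.2 fun ε hε δ _ => ?_
  filter_upwards [(tendsto_zero_iff_norm_tendsto_zero.1 hc).eventually_lt_const hε] with i hi
  simp [hi.not_ge]

theorem tendstoInMeasure_zero_add {V W : ι → Ω → E} (hV : TendstoInMeasure P V l 0)
    (hW : TendstoInMeasure P W l 0) : TendstoInMeasure P (fun i ω => V i ω + W i ω) l 0 := by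
  rw [tendstoInMeasure_zero_iff] at *
  intro ε hε δ hδ
  have hδ2 := ENNReal.half_pos hδ.ne'
  filter_upwards [hV _ (half_pos hε) _ hδ2, hW _ (half_pos hε) _ hδ2] with i h1 h2
  refine measure_le_of_subset_union (fun ω hω => ?_) h1 h2
  by_contra! h
  simp only [Set.mem_union, Set.mem_ofPred_eq, not_or, not_le] at h hω
  linarith [norm_add_le (V i ω) (W i ω)]

theorem tendstoInMeasure_zero_prodMk {V : ι → Ω → E} {W : ι → Ω → F}
    (hV : TendstoInMeasure P V l 0) (hW : TendstoInMeasure P W l 0) :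
    TendstoInMeasure P (fun i ω => (V i ω, W i ω)) l 0 := by
  rw [tendstoInMeasure_zero_iff] at *
  intro ε hε δ hδ
  have hδ2 := ENNReal.half_pos hδ.ne'
  filter_upwards [hV ε hε _ hδ2, hW ε hε _ hδ2] with i h1 h2
  exact measure_le_of_subset_union
    (fun ω (hω : ε ≤ max ‖V i ω‖ ‖W i ω‖) => le_max_iff.1 hω) h1 h2

theorem tendstoInMeasure_zero_clm_comp {V : ι → Ω → E} [NormedSpace ℝ E] [NormedSpace ℝ F]
    (L : E →L[ℝ] F) (hV : TendstoInMeasure P V l 0) :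
    TendstoInMeasure P (fun i ω => L (V i ω)) l 0 := by
  rw [tendstoInMeasure_zero_iff] at *
  intro ε hε δ hδ
  have hL : 0 < ‖L‖ + 1 := by positivity
  filter_upwards [hV (ε / (‖L‖ + 1)) (div_pos hε hL) δ hδ] with i hi
  refine (measure_mono fun ω (hω : ε ≤ ‖L (V i ω)‖) => ?_).trans hi
  refine (div_le_iff₀' hL).2 (hω.trans ((L.le_opNorm _).trans ?_))
  gcongr
  linarith

namespace BoundedInProb

theorem prodMk {V : ι → Ω → E} {W : ι → Ω → F} (hV : BoundedInProb P V l)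
    (hW : BoundedInProb P W l) : BoundedInProb P (fun i ω => (V i ω, W i ω)) l := by
  intro δ hδ
  obtain ⟨M, hM, hMV⟩ := hV (δ / 2) (ENNReal.half_pos hδ.ne')
  obtain ⟨K, -, hKW⟩ := hW (δ / 2) (ENNReal.half_pos hδ.ne')
  refine ⟨max M K, lt_max_of_lt_left hM, ?_⟩
  filter_upwards [hMV, hKW] with i h1 h2
  refine measure_le_of_subset_union (fun ω hω => ?_) h1 h2
  exact (le_max_iff.1 hω).imp (le_max_left M K).trans (le_max_right M K).trans

theorem of_tendstoInMeasure_sub {V W : ι → Ω → E} (hW : BoundedInProb P W l)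
    (h : TendstoInMeasure P (fun i ω => V i ω - W i ω) l 0) : BoundedInProb P V l := by
  intro δ hδ
  have hδ2 := ENNReal.half_pos hδ.ne'
  obtain ⟨M, hM, hMW⟩ := hW (δ / 2) hδ2
  refine ⟨M + 1, by linarith, ?_⟩
  filter_upwards [hMW, tendstoInMeasure_zero_iff.1 h 1 one_pos _ hδ2] with i h1 h2
  refine measure_le_of_subset_union (fun ω hω => ?_) h1 h2
  by_contra! hlt
  simp only [Set.mem_union, Set.mem_ofPred_eq, not_or, not_le] at hlt hω
  linarith [norm_le_insert' (V i ω) (W i ω)]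

variable [NormedSpace ℝ E] [NormedSpace ℝ F] {A : ι → Ω → E} {r : ι → ℝ} {x : E}

theorem tendstoInMeasure_sub_zero (hA : BoundedInProb P (fun i ω => r i • (A i ω - x)) l)
    (hr : Tendsto r l atTop) : TendstoInMeasure P (fun i ω => A i ω - x) l 0 := by
  refine tendstoInMeasure_zero_iff.2 fun η hη δ hδ => ?_
  obtain ⟨M, hM, hMA⟩ := hA δ hδ
  filter_upwards [hMA, hr.eventually_ge_atTop (M / η)] with i h1 h2
  refine (measure_mono fun ω (hω : η ≤ ‖A i ω - x‖) => ?_).trans h1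
  have hri : 0 < r i := (div_pos hM hη).trans_le h2
  calc M = M / η * η := (div_mul_cancel₀ M hη.ne').symm
    _ ≤ r i * ‖A i ω - x‖ := by gcongr
    _ = ‖r i • (A i ω - x)‖ := by rw [norm_smul, Real.norm_of_nonneg hri.le]

/-- The delta method. -/
theorem tendstoInMeasure_smul_sub_sub_fderiv {g : E → F} {g' : E →L[ℝ] F}
    (hA : BoundedInProb P (fun i ω => r i • (A i ω - x)) l) (hr : Tendsto r l atTop)
    (hg : HasFDerivAt g g' x) :
    TendstoInMeasure P (fun i ω => r i • (g (A i ω) - g x) - g' (r i • (A i ω - x))) l 0 := by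
  refine tendstoInMeasure_zero_iff.2 fun ε hε δ hδ => ?_
  have hδ2 := ENNReal.half_pos hδ.ne'
  obtain ⟨M, hM, hMA⟩ := hA (δ / 2) hδ2
  obtain ⟨η, hη, hlin⟩ :=
    Metric.eventually_nhds_iff.1 ((hasFDerivAt_iff_isLittleO.1 hg).def (div_pos hε hM))
  filter_upwards [hMA, tendstoInMeasure_zero_iff.1 (hA.tendstoInMeasure_sub_zero hr) η hη _ hδ2,
    hr.eventually_gt_atTop 0] with i h1 h2 hri
  refine measure_le_of_subset_union (fun ω hω => ?_) h1 h2
  by_contra! h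
  simp only [Set.mem_union, Set.mem_ofPred_eq, not_or, not_le] at h hω
  have hri' : ‖r i‖ = r i := Real.norm_of_nonneg hri.le
  refine hω.not_gt ?_
  calc ‖r i • (g (A i ω) - g x) - g' (r i • (A i ω - x))‖
      = r i * ‖g (A i ω) - g x - g' (A i ω - x)‖ := by
        rw [map_smul, ← smul_sub, norm_smul, hri']
    _ ≤ r i * (ε / M * ‖A i ω - x‖) := by gcongr; exact hlin (by rw [dist_eq_norm]; exact h.2)
    _ = ε / M * ‖r i • (A i ω - x)‖ := by rw [norm_smul, hri']; ring
    _ < ε / M * M := by gcongr; exact h.1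
    _ = ε := div_mul_cancel₀ ε hM.ne'

end BoundedInProb

theorem exists_int_mul_between {ε M v w : ℝ} (hε : 0 < ε) (hw : |w| < M)
    (hvw : 3 * ε ≤ |v - w|) :
    ∃ m ∈ Finset.Icc (-(⌈M / ε⌉ + 2)) (⌈M / ε⌉ + 2),
      w + ε ≤ m * ε ∧ m * ε < v ∨ v ≤ m * ε ∧ m * ε ≤ w - ε := by
  obtain ⟨hMw, hwM⟩ := abs_lt.1 hw
  have hfloor_le : ⌊w / ε⌋ * ε ≤ w := (le_div_iff₀ hε).1 (Int.floor_le _)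
  have hlt_floor : w < (⌊w / ε⌋ + 1) * ε := (div_lt_iff₀ hε).1 (Int.lt_floor_add_one _)
  have hfloor_upper : ⌊w / ε⌋ ≤ ⌈M / ε⌉ := by
    have h : w / ε ≤ M / ε := by gcongr
    exact_mod_cast (Int.floor_le _).trans (h.trans (Int.le_ceil _))
  have hfloor_lower : -⌈M / ε⌉ ≤ ⌊w / ε⌋ := by
    rw [← Int.floor_neg, ← neg_div]
    gcongr
  rcases le_abs'.1 hvw with h | h
  · refine ⟨⌊w / ε⌋ - 1, Finset.mem_Icc.2 ⟨by omega, by omega⟩, Or.inr ?_⟩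
    push_cast
    exact ⟨by linarith, by linarith⟩
  · refine ⟨⌊w / ε⌋ + 2, Finset.mem_Icc.2 ⟨by omega, by omega⟩, Or.inl ?_⟩
    push_cast
    exact ⟨by linarith, by linarith⟩

/-- Ghosh's lemma. Tightness of `W` leaves finitely many levels `t` to be compared. -/
theorem tendstoInMeasure_sub_of_forall_le_iff {V W : ι → Ω → ℝ} {S : ℝ → ι → Ω → ℝ}
    (hW : BoundedInProb P W l) (hVS : ∀ t, ∀ᶠ i in l, ∀ ω, V i ω ≤ t ↔ S t i ω ≤ t)
    (hSW : ∀ t, TendstoInMeasure P (fun i ω => S t i ω - W i ω) l 0) :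
    TendstoInMeasure P (fun i ω => V i ω - W i ω) l 0 := by
  refine tendstoInMeasure_zero_iff.2 fun ε₃ hε₃ δ hδ => ?_
  obtain ⟨ε, hε, rfl⟩ : ∃ ε, 0 < ε ∧ ε₃ = 3 * ε := ⟨ε₃ / 3, by positivity, by ring⟩
  have hδ2 := ENNReal.half_pos hδ.ne'
  obtain ⟨M, -, hMW⟩ := hW (δ / 2) hδ2
  set I := Finset.Icc (-(⌈M / ε⌉ + 2)) (⌈M / ε⌉ + 2)
  have hgrid : ∀ᶠ i in l, ∑ m ∈ I, P {ω | ε ≤ ‖S (m * ε) i ω - W i ω‖} ≤ δ / 2 := by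
    have hsum : Tendsto (fun i => ∑ m ∈ I, P {ω | ε ≤ ‖S (m * ε) i ω - W i ω‖}) l
        (𝓝 (∑ _m ∈ I, 0)) :=
      tendsto_finsetSum I fun m _ => by
        simpa using tendstoInMeasure_iff_norm.1 (hSW (m * ε)) ε hε
    rw [Finset.sum_const_zero] at hsum
    exact ENNReal.tendsto_nhds_zero.1 hsum _ hδ2
  have hcompare : ∀ᶠ i in l, ∀ m ∈ I, ∀ ω, V i ω ≤ m * ε ↔ S (m * ε) i ω ≤ m * ε :=
    (Filter.eventually_all_finset I).2 fun m _ => hVS (m * ε)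
  filter_upwards [hMW, hgrid, hcompare] with i h1 h2 hiff
  refine measure_le_of_subset_union (fun ω hω => ?_) h1
    ((measure_biUnion_finset_le I _).trans h2)
  by_contra! hgood
  simp only [Set.mem_union, Set.mem_iUnion, Set.mem_ofPred_eq, not_or, not_exists, not_le,
    Real.norm_eq_abs] at hω hgood
  obtain ⟨m, hm, ⟨hwm, hmv⟩ | ⟨hvm, hmw⟩⟩ := exists_int_mul_between hε hgood.1 hω
  all_goals
    have hclose := abs_lt.1 (hgood.2 m hm)
    have hiffm := hiff m hm ω
  · exact hmv.not_ge (hiffm.2 (by linarith))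
  · linarith [hiffm.1 hvm]

end InProbability

/-- The centred and normalized sum `n^{-1/2} ∑_{i < n} (g(Y_i) - ∫ g dμ)` of a function of the first
`n` observations on the law `μ`. -/
noncomputable def normalizedSum {Ω α E : Type*} [MeasurableSpace α] [NormedAddCommGroup E]
    [NormedSpace ℝ E] (μ : Measure α) (Y : ℕ → Ω → α) (g : α → E) (n : ℕ) (ω : Ω) : E :=
  (√n)⁻¹ • (∑ i ∈ Finset.range n, g (Y i ω) - (n : ℝ) • ∫ z, g z ∂μ)

section NormalizedSumAlgebra

variable {Ω α E F : Type*} [MeasurableSpace α] {μ : Measure α} {Y : ℕ → Ω → α}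
  [NormedAddCommGroup E] [NormedSpace ℝ E] [NormedAddCommGroup F] [NormedSpace ℝ F]

theorem normalizedSum_sub {g h : α → E} (hg : Integrable g μ) (hh : Integrable h μ) (n : ℕ)
    (ω : Ω) : normalizedSum μ Y (g - h) n ω =
      normalizedSum μ Y g n ω - normalizedSum μ Y h n ω := by
  simp only [normalizedSum, Pi.sub_apply, Finset.sum_sub_distrib, integral_sub hg hh,
    ← smul_sub]
  congr 1
  rw [smul_sub]
  abel

theorem clm_normalizedSum [CompleteSpace E] [CompleteSpace F] (L : E →L[ℝ] F) {g : α → E}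
    (hg : Integrable g μ) (n : ℕ) (ω : Ω) :
    L (normalizedSum μ Y g n ω) = normalizedSum μ Y (fun z => L (g z)) n ω := by
  simp only [normalizedSum, map_smul, map_sub, map_sum, L.integral_comp_comm hg]

theorem normalizedSum_prodMk [CompleteSpace E] [CompleteSpace F] {g : α → E} {h : α → F}
    (hg : Integrable g μ) (hh : Integrable h μ) (n : ℕ) :
    normalizedSum μ Y (fun z => (g z, h z)) n =
      fun ω => (normalizedSum μ Y g n ω, normalizedSum μ Y h n ω) := by
  ext ω <;> simp [normalizedSum, integral_pair hg hh, Prod.fst_sum, Prod.snd_sum]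

end NormalizedSumAlgebra

theorem tendsto_sqrt_natCast_atTop {ι : Type*} {l : Filter ι} {N : ι → ℕ}
    (hN : Tendsto N l atTop) :
    Tendsto (fun i => √(N i : ℝ)) l atTop :=
  Real.tendsto_sqrt_atTop.comp (tendsto_natCast_atTop_atTop.comp hN)

section NormalizedSum

variable {ι Ω α : Type*} [MeasurableSpace Ω] [MeasurableSpace α] {P : Measure Ω}
  {μ : Measure α} {Y : ℕ → Ω → α} {g : α → ℝ} {l : Filter ι} {N : ι → ℕ}

theorem identDistrib_comp_of_hasLaw (hlaw : ∀ i, HasLaw (Y i) μ P) (hg : Measurable g) (i : ℕ) :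
    IdentDistrib (fun ω => g (Y i ω)) g P μ :=
  ((hlaw i).identDistrib HasLaw.id).comp hg

theorem memLp_normalizedSum [IsFiniteMeasure P] (hlaw : ∀ i, HasLaw (Y i) μ P)
    (hg : Measurable g) (hg2 : MemLp g 2 μ) (n : ℕ) : MemLp (normalizedSum μ Y g n) 2 P :=
  ((memLp_finsetSum (Finset.range n) fun i _ =>
    (identDistrib_comp_of_hasLaw hlaw hg i).memLp_iff.2 hg2).sub
      (memLp_const ((n : ℝ) • ∫ z, g z ∂μ))).const_smul (√n)⁻¹

theorem integral_normalizedSum [IsProbabilityMeasure P] (hlaw : ∀ i, HasLaw (Y i) μ P)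
    (hg : Measurable g) (hgint : Integrable g μ) (n : ℕ) : P[normalizedSum μ Y g n] = 0 := by
  have hident := identDistrib_comp_of_hasLaw hlaw hg
  have hint (i : ℕ) : Integrable (fun ω => g (Y i ω)) P := (hident i).integrable_iff.2 hgint
  have hmean (i : ℕ) : ∫ ω, g (Y i ω) ∂P = ∫ z, g z ∂μ := (hident i).integral_eq
  simp only [normalizedSum]
  rw [integral_smul, integral_sub (integrable_finsetSum _ fun i _ => hint i) (integrable_const _),
    integral_finsetSum _ fun i _ => hint i]
  simp [hmean]

theorem variance_normalizedSum_le [IsProbabilityMeasure P] (hlaw : ∀ i, HasLaw (Y i) μ P)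
    (hindep : iIndepFun Y P) (hg : Measurable g) (hg2 : MemLp g 2 μ) (n : ℕ) :
    Var[normalizedSum μ Y g n; P] ≤ Var[g; μ] := by
  have hident := identDistrib_comp_of_hasLaw hlaw hg
  have hmem (i : ℕ) : MemLp (fun ω => g (Y i ω)) 2 P := (hident i).memLp_iff.2 hg2
  have hsum : Var[fun ω => ∑ i ∈ Finset.range n, g (Y i ω); P] = n * Var[g; μ] := by
    rw [← Finset.sum_fn, IndepFun.variance_sum (fun i _ => hmem i)
      fun i _ j _ hij => (hindep.indepFun hij).comp hg hg]
    simp [fun i => (hident i).variance_eq]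
  have hvar : Var[normalizedSum μ Y g n; P] = (√n)⁻¹ ^ 2 * (n * Var[g; μ]) := by
    rw [← hsum, ← variance_sub_const (memLp_finsetSum _ fun i _ => hmem i).aestronglyMeasurable
      ((n : ℝ) • ∫ z, g z ∂μ), ← variance_const_mul]
    rfl
  rw [hvar, inv_pow, Real.sq_sqrt n.cast_nonneg]
  rcases eq_or_ne n 0 with rfl | hn
  · simp [variance_nonneg]
  · rw [inv_mul_cancel_left₀ (Nat.cast_ne_zero.2 hn)]

theorem measure_le_abs_normalizedSum_le [IsProbabilityMeasure P] [IsFiniteMeasure μ]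
    (hlaw : ∀ i, HasLaw (Y i) μ P) (hindep : iIndepFun Y P) (hg : Measurable g)
    (hg2 : MemLp g 2 μ) (n : ℕ) {c : ℝ} (hc : 0 < c) :
    P {ω | c ≤ ‖normalizedSum μ Y g n ω‖} ≤ ENNReal.ofReal (Var[g; μ] / c ^ 2) := by
  have hcheb := meas_ge_le_variance_div_sq (memLp_normalizedSum hlaw hg hg2 n) hc
  simp only [integral_normalizedSum hlaw hg (hg2.integrable one_le_two), sub_zero] at hcheb
  refine hcheb.trans (ENNReal.ofReal_le_ofReal ?_)
  gcongr
  exact variance_normalizedSum_le hlaw hindep hg hg2 n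

theorem boundedInProb_normalizedSum [IsProbabilityMeasure P] [IsFiniteMeasure μ]
    (hlaw : ∀ i, HasLaw (Y i) μ P) (hindep : iIndepFun Y P) (hg : Measurable g)
    (hg2 : MemLp g 2 μ) : BoundedInProb P (fun i => normalizedSum μ Y g (N i)) l := by
  intro δ hδ
  have hlim : Tendsto (fun c : ℝ => ENNReal.ofReal (Var[g; μ] / c ^ 2)) atTop (𝓝 0) := by
    simpa using ENNReal.tendsto_ofReal
      ((tendsto_pow_atTop two_ne_zero).const_div_atTop Var[g; μ])
  obtain ⟨c, hcδ, hc⟩ :=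
    ((ENNReal.tendsto_nhds_zero.1 hlim δ hδ).and (eventually_gt_atTop 0)).exists
  exact ⟨c, hc, Eventually.of_forall fun i =>
    (measure_le_abs_normalizedSum_le hlaw hindep hg hg2 (N i) hc).trans hcδ⟩

theorem tendstoInMeasure_normalizedSum_of_variance_tendsto_zero [IsProbabilityMeasure P]
    [IsFiniteMeasure μ] (hlaw : ∀ i, HasLaw (Y i) μ P) (hindep : iIndepFun Y P) {h : ι → α → ℝ}
    (hh : ∀ i, Measurable (h i)) (hh2 : ∀ i, MemLp (h i) 2 μ)
    (hvar : Tendsto (fun i => Var[h i; μ]) l (𝓝 0)) :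
    TendstoInMeasure P (fun i => normalizedSum μ Y (h i) (N i)) l 0 := by
  refine tendstoInMeasure_zero_iff.2 fun ε hε => ENNReal.tendsto_nhds_zero.1 ?_
  have hbound : Tendsto (fun i => ENNReal.ofReal (Var[h i; μ] / ε ^ 2)) l (𝓝 0) := by
    simpa using ENNReal.tendsto_ofReal (hvar.div_const (ε ^ 2))
  exact tendsto_of_tendsto_of_tendsto_of_le_of_le tendsto_const_nhds hbound
    (fun _ => zero_le) fun i =>
      measure_le_abs_normalizedSum_le hlaw hindep (hh i) (hh2 i) (N i) hε

theorem tendstoInDistribution_normalizedSum [IsProbabilityMeasure P]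
    (hlaw : ∀ i, HasLaw (Y i) μ P) (hindep : iIndepFun Y P) (hg : Measurable g)
    (hg2 : MemLp g 2 μ) (hN : Tendsto N l atTop) :
    TendstoInDistribution (fun i => normalizedSum μ Y g (N i)) l id (fun _ => P)
      (gaussianReal 0 Var[g; μ].toNNReal) := by
  have hident := identDistrib_comp_of_hasLaw hlaw hg
  have hclt := tendstoInDistribution_inv_sqrt_mul_sum_sub (P := P) (X := fun i ω => g (Y i ω))
    (by rw [(hident 0).variance_eq]; exact HasLaw.id) ((hident 0).memLp_iff.2 hg2)
    (hindep.comp _ fun _ => hg) fun i => (hident i).trans (hident 0).symm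
  rw [(hident 0).integral_eq] at hclt
  exact ⟨fun i => hclt.forall_aemeasurable (N i), hclt.aemeasurable_limit, hclt.tendsto.comp hN⟩

/-- The delta method for a statistic `A` that is asymptotically linear with influence
function `q`. -/
theorem tendstoInDistribution_sqrt_mul_comp_sub {E : Type*} [NormedAddCommGroup E]
    [NormedSpace ℝ E] [CompleteSpace E] [MeasurableSpace E] [BorelSpace E]
    [IsProbabilityMeasure P] [IsFiniteMeasure μ] [l.IsCountablyGenerated]
    (hlaw : ∀ i, HasLaw (Y i) μ P) (hindep : iIndepFun Y P) (hN : Tendsto N l atTop)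
    {q : α → E} (hq : Measurable q) (hq2 : MemLp q 2 μ)
    (hbdd : BoundedInProb P (fun i => normalizedSum μ Y q (N i)) l)
    {A : ι → Ω → E} {x : E} (hA : ∀ i, AEMeasurable (A i) P)
    (hlin : TendstoInMeasure P
      (fun i ω => √(N i) • (A i ω - x) - normalizedSum μ Y q (N i) ω) l 0)
    {g : E → ℝ} (hg : Measurable g) {g' : E →L[ℝ] ℝ} (hg' : HasFDerivAt g g' x) :
    TendstoInDistribution (fun i ω => √(N i) * (g (A i ω) - g x)) l id (fun _ => P)
      (gaussianReal 0 Var[fun z => g' (q z); μ].toNNReal) := by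
  have hdelta := (hbdd.of_tendstoInMeasure_sub hlin).tendstoInMeasure_smul_sub_sub_fderiv
    (tendsto_sqrt_natCast_atTop hN) hg'
  refine tendstoInDistribution_of_tendstoInMeasure_sub _ _ (tendstoInDistribution_normalizedSum
    hlaw hindep (g'.measurable.comp hq) (g'.comp_memLp' hq2) hN) ?_
    fun i => ((hg.comp_aemeasurable (hA i)).sub_const _).const_mul _
  refine (tendstoInMeasure_zero_add hdelta
    (tendstoInMeasure_zero_clm_comp g' hlin)).congr_left fun i => ae_of_all _ fun ω => ?_
  rw [map_sub, clm_normalizedSum g' (hq2.integrable one_le_two), sub_add_sub_cancel]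
  rfl

end NormalizedSum

/-- The influence function of the quantile functional at a quantile `t` where the density is `d`,
up to an additive constant, which normalized sums do not see. -/
noncomputable def quantileInfluence (t d : ℝ) : ℝ → ℝ := (-d⁻¹) • iicIndicator t

section QuantileInfluence

variable {μ : Measure ℝ} [IsProbabilityMeasure μ] {s t d e : ℝ}

theorem memLp_iicIndicator : MemLp (iicIndicator t) 2 μ :=
  memLp_indicator_const 2 measurableSet_Iic 1 (Or.inr (measure_ne_top _ _))

theorem integral_iicIndicator : ∫ z, iicIndicator t z ∂μ = cdf μ t := by
  rw [integral_indicator_one measurableSet_Iic, cdf_eq_real]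

theorem measurable_quantileInfluence : Measurable (quantileInfluence t d) :=
  (measurable_one.indicator measurableSet_Iic).const_smul _

theorem memLp_quantileInfluence : MemLp (quantileInfluence t d) 2 μ :=
  memLp_iicIndicator.const_smul _

theorem integrable_quantileInfluence : Integrable (quantileInfluence t d) μ :=
  memLp_quantileInfluence.integrable one_le_two

theorem covariance_quantileInfluence :
    cov[quantileInfluence s d, quantileInfluence t e; μ] =
      d⁻¹ * e⁻¹ * (cdf μ (min s t) - cdf μ s * cdf μ t) := by
  have hmul : iicIndicator s * iicIndicator t = iicIndicator (min s t) := by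
    rw [iicIndicator, iicIndicator, ← Set.inter_indicator_one, Set.Iic_inter_Iic]
  rw [quantileInfluence, quantileInfluence, covariance_smul_left, covariance_smul_right,
    covariance_eq_sub memLp_iicIndicator memLp_iicIndicator, hmul]
  simp only [integral_iicIndicator]
  ring

theorem variance_quantileInfluence_sub :
    Var[quantileInfluence s d - quantileInfluence t e; μ] =
      d⁻¹ ^ 2 * (cdf μ s - cdf μ s ^ 2)
        - 2 * (d⁻¹ * e⁻¹ * (cdf μ (min s t) - cdf μ s * cdf μ t))
        + e⁻¹ ^ 2 * (cdf μ t - cdf μ t ^ 2) := by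
  rw [variance_sub memLp_quantileInfluence memLp_quantileInfluence,
    ← covariance_self measurable_quantileInfluence.aemeasurable,
    ← covariance_self measurable_quantileInfluence.aemeasurable]
  simp only [covariance_quantileInfluence, min_self]
  ring

theorem tendsto_variance_quantileInfluence_sub {ι : Type*} {l : Filter ι} {u : ι → ℝ}
    (hc : ContinuousAt (cdf μ) t) (hu : Tendsto u l (𝓝 t)) :
    Tendsto (fun i => Var[quantileInfluence (u i) d - quantileInfluence t d; μ]) l (𝓝 0) := by
  have hFu : Tendsto (fun i => cdf μ (u i)) l (𝓝 (cdf μ t)) := hc.tendsto.comp hu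
  have hFmin : Tendsto (fun i => cdf μ (min (u i) t)) l (𝓝 (cdf μ t)) := by
    refine hc.tendsto.comp ?_
    simpa using hu.min (tendsto_const_nhds (x := t))
  simp only [variance_quantileInfluence_sub]
  convert! (((hFu.sub (hFu.pow 2)).const_mul (d⁻¹ ^ 2)).sub
    (((hFmin.sub (hFu.mul_const (cdf μ t))).const_mul (d⁻¹ * d⁻¹)).const_mul 2)).add_const
      (d⁻¹ ^ 2 * (cdf μ t - cdf μ t ^ 2)) using 2
  ring

end QuantileInfluence

/-- The order statistics of rank `j i` in samples of size `N i` are central of level `p`: the sample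
sizes grow along `l`, and the ranks are admissible and equal to `p N` up to `o(√N)`. -/
structure IsCentralRank {ι : Type*} (p : ℝ) (N j : ι → ℕ) (l : Filter ι) : Prop where
  tendsto_size : Tendsto N l atTop
  one_le_and_le : ∀ᶠ i in l, 1 ≤ j i ∧ j i ≤ N i
  tendsto_sub_div_sqrt : Tendsto (fun i => ((j i : ℝ) - N i * p) / √(N i)) l (𝓝 0)

section CentralOrderStat

variable {ι Ω : Type*} {μ : Measure ℝ} {Y : ℕ → Ω → ℝ} {l : Filter ι} {N j k : ι → ℕ}
  {x y d e : ℝ}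

theorem sqrt_mul_orderStat_sub_le_iff [IsProbabilityMeasure μ] {n r : ℕ} (hr : 1 ≤ r ∧ r ≤ n)
    (hd : 0 < d) (t : ℝ) (ω : Ω) :
    √n * (orderStat (fun m : Fin n => Y m ω) r - x) ≤ t ↔
      normalizedSum μ Y (quantileInfluence (x + (√n)⁻¹ * t) d) n ω +
        (t + d⁻¹ * ((r - n * cdf μ (x + (√n)⁻¹ * t)) / √n)) ≤ t := by
  have hn : 0 < √(n : ℝ) := Real.sqrt_pos.2 (by exact_mod_cast hr.1.trans hr.2)
  set u := x + (√n)⁻¹ * t with hu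
  set C := ∑ m ∈ Finset.range n, iicIndicator u (Y m ω) with hC
  have hlevel : √n * (orderStat (fun m : Fin n => Y m ω) r - x) ≤ t ↔ (r : ℝ) ≤ C := by
    rw [← le_inv_mul_iff₀ hn, sub_le_iff_le_add', ← hu, orderStat_le_iff hr, hC,
      Finset.sum_range]
  have hcount : t - (normalizedSum μ Y (quantileInfluence u d) n ω +
      (t + d⁻¹ * ((r - n * cdf μ u) / √n))) = d⁻¹ * (√n)⁻¹ * (C - r) := by
    simp only [normalizedSum, quantileInfluence, Pi.smul_apply, smul_eq_mul, ← Finset.mul_sum,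
      integral_const_mul, integral_iicIndicator, ← hC]
    ring
  rw [hlevel, ← sub_nonneg, ← sub_nonneg (a := t), hcount,
    mul_nonneg_iff_of_pos_left (by positivity)]

theorem tendsto_add_inv_mul_sub_div_sqrt {F : ℝ → ℝ} (hF : HasDerivAt F d x) (hd : d ≠ 0)
    (hj : IsCentralRank (F x) N j l) (t : ℝ) :
    Tendsto (fun i => t + d⁻¹ * ((j i - N i * F (x + (√(N i))⁻¹ * t)) / √(N i))) l (𝓝 0) := by
  have hslope : Tendsto (fun i => √(N i : ℝ) * (F (x + (√(N i))⁻¹ * t) - F x)) l (𝓝 (t * d)) := by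
    simpa using hF.hasFDerivAt.lim t
      (tendsto_norm_atTop_atTop.comp (tendsto_sqrt_natCast_atTop hj.tendsto_size))
  have hlim := ((hj.tendsto_sub_div_sqrt.sub hslope).const_mul d⁻¹).const_add t
  have hzero : t + d⁻¹ * (0 - t * d) = 0 := by field_simp; ring
  rw [hzero] at hlim
  refine hlim.congr' ?_
  filter_upwards [hj.tendsto_size.eventually_gt_atTop 0] with i hi
  have hNi : (0 : ℝ) < N i := Nat.cast_pos.2 hi
  have hsq : √(N i : ℝ) * √(N i) = N i := Real.mul_self_sqrt hNi.le
  generalize F (x + (√(N i : ℝ))⁻¹ * t) = a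
  field_simp
  linear_combination (F x - a) * hsq

variable [MeasurableSpace Ω] {P : Measure Ω}

theorem tendstoInMeasure_sqrt_mul_orderStat_sub_normalizedSum [IsProbabilityMeasure P]
    [IsProbabilityMeasure μ] (hlaw : ∀ i, HasLaw (Y i) μ P) (hindep : iIndepFun Y P)
    (hF : HasDerivAt (cdf μ) d x) (hd : 0 < d) (hj : IsCentralRank (cdf μ x) N j l) :
    TendstoInMeasure P (fun i ω => √(N i) * (orderStat (fun m : Fin (N i) => Y m ω) (j i) - x) -
      normalizedSum μ Y (quantileInfluence x d) (N i) ω) l 0 := by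
  refine tendstoInMeasure_sub_of_forall_le_iff
    (S := fun t i ω => normalizedSum μ Y (quantileInfluence (x + (√(N i))⁻¹ * t) d) (N i) ω +
      (t + d⁻¹ * ((j i - N i * cdf μ (x + (√(N i))⁻¹ * t)) / √(N i))))
    (boundedInProb_normalizedSum hlaw hindep measurable_quantileInfluence memLp_quantileInfluence)
    (fun t => hj.one_le_and_le.mono fun i hi => sqrt_mul_orderStat_sub_le_iff hi hd t) fun t => ?_
  have hlevel : Tendsto (fun i => x + (√(N i : ℝ))⁻¹ * t) l (𝓝 x) := by
    simpa using ((tendsto_inv_atTop_zero.comp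
      (tendsto_sqrt_natCast_atTop hj.tendsto_size)).mul_const t).const_add x
  have hrandom := tendstoInMeasure_normalizedSum_of_variance_tendsto_zero (N := N) hlaw hindep
    (fun i => (measurable_quantileInfluence (t := x + (√(N i : ℝ))⁻¹ * t) (d := d)).sub
      (measurable_quantileInfluence (t := x) (d := d)))
    (fun i => memLp_quantileInfluence.sub memLp_quantileInfluence)
    (tendsto_variance_quantileInfluence_sub hF.continuousAt hlevel)
  refine (tendstoInMeasure_zero_add hrandom (tendstoInMeasure_zero_of_tendsto
    (tendsto_add_inv_mul_sub_div_sqrt hF hd.ne' hj t))).congr_left fun i => ae_of_all _ fun ω => ?_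
  simp only [normalizedSum_sub integrable_quantileInfluence integrable_quantileInfluence]
  ring

theorem tendstoInDistribution_sqrt_mul_comp_orderStat_sub [IsProbabilityMeasure P]
    [IsProbabilityMeasure μ] [l.IsCountablyGenerated] (hlaw : ∀ i, HasLaw (Y i) μ P)
    (hindep : iIndepFun Y P) (hFx : HasDerivAt (cdf μ) d x) (hd : 0 < d)
    (hFy : HasDerivAt (cdf μ) e y) (he : 0 < e) (hj : IsCentralRank (cdf μ x) N j l)
    (hk : IsCentralRank (cdf μ y) N k l) {g : ℝ × ℝ → ℝ} (hg : Measurable g)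
    {g' : ℝ × ℝ →L[ℝ] ℝ} (hg' : HasFDerivAt g g' (x, y)) :
    TendstoInDistribution
      (fun i ω => √(N i) * (g (orderStat (fun m : Fin (N i) => Y m ω) (j i),
        orderStat (fun m : Fin (N i) => Y m ω) (k i)) - g (x, y)))
      l id (fun _ => P)
      (gaussianReal 0
        Var[fun z => g' (quantileInfluence x d z, quantileInfluence y e z); μ].toNNReal) := by
  have hsum := normalizedSum_prodMk (Y := Y)
    (integrable_quantileInfluence (μ := μ) (t := x) (d := d))
    (integrable_quantileInfluence (μ := μ) (t := y) (d := e))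
  refine tendstoInDistribution_sqrt_mul_comp_sub (x := (x, y)) hlaw hindep hj.tendsto_size
    (measurable_quantileInfluence.prodMk measurable_quantileInfluence)
    (MemLp.of_fst_snd ⟨memLp_quantileInfluence, memLp_quantileInfluence⟩) ?_ (fun i => ?_) ?_ hg hg'
  · simp only [hsum]
    exact (boundedInProb_normalizedSum hlaw hindep measurable_quantileInfluence
      memLp_quantileInfluence).prodMk (boundedInProb_normalizedSum hlaw hindep
        measurable_quantileInfluence memLp_quantileInfluence)
  · have hsample : AEMeasurable (fun ω (m : Fin (N i)) => Y m ω) P :=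
      aemeasurable_pi_lambda _ fun m => (hlaw m).aemeasurable
    exact ((measurable_orderStat (j i)).prodMk (measurable_orderStat (k i))).comp_aemeasurable
      hsample
  · simp only [hsum]
    exact tendstoInMeasure_zero_prodMk
      (tendstoInMeasure_sqrt_mul_orderStat_sub_normalizedSum hlaw hindep hFx hd hj)
      (tendstoInMeasure_sqrt_mul_orderStat_sub_normalizedSum hlaw hindep hFy he hk)

end CentralOrderStat

section LogRatio

variable {μ : Measure ℝ} {s : ℕ} {x y d e a b : ℝ}

theorem hasFDerivAt_log_div (hx : x ≠ 0) (hy : y ≠ 0) :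
    HasFDerivAt (fun u : ℝ × ℝ => Real.log (u.2 / u.1))
      (y⁻¹ • ContinuousLinearMap.snd ℝ ℝ ℝ - x⁻¹ • ContinuousLinearMap.fst ℝ ℝ ℝ) (x, y) := by
  have hsnd : HasFDerivAt (Prod.snd : ℝ × ℝ → ℝ) (ContinuousLinearMap.snd ℝ ℝ ℝ) (x, y) :=
    hasFDerivAt_snd
  refine ((hsnd.log hy).sub (hasFDerivAt_fst.log hx)).congr_of_eventuallyEq ?_
  have hne : ∀ᶠ u : ℝ × ℝ in 𝓝 (x, y), u.1 ≠ 0 ∧ u.2 ≠ 0 :=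
    (continuousAt_fst.eventually_ne hx).and (continuousAt_snd.eventually_ne hy)
  filter_upwards [hne] with u hu using Real.log_div hu.2 hu.1

theorem smul_quantileInfluence (c : ℝ) :
    c⁻¹ • quantileInfluence x d = quantileInfluence x (c * d) := by
  simp only [quantileInfluence, smul_smul, mul_inv, mul_neg]

theorem variance_quantileInfluence_sub_eq_asympVariance [IsProbabilityMeasure μ]
    (hFx : cdf μ x = 1 / ((s : ℝ) + 1)) (hFy : cdf μ y = (s : ℝ) / ((s : ℝ) + 1)) (hxy : x ≤ y) :
    Var[quantileInfluence y b - quantileInfluence x a; μ] = asympVariance s a b := by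
  have hs : (s : ℝ) + 1 ≠ 0 := by positivity
  rw [variance_quantileInfluence_sub, min_eq_right hxy, hFx, hFy, asympVariance]
  simp only [div_eq_mul_inv, mul_inv, ← inv_pow (a := a), ← inv_pow (a := b)]
  generalize a⁻¹ = a', b⁻¹ = b'
  field_simp
  ring

theorem asympVariance_pos (hs : 2 ≤ s) (ha : a ≠ 0) : 0 < asympVariance s a b := by
  have hs' : (2 : ℝ) ≤ s := by exact_mod_cast hs
  have hsquares : (s : ℝ) / a ^ 2 - 2 / (a * b) + s / b ^ 2 =
      (a⁻¹ - b⁻¹) ^ 2 + (s - 1) * (a⁻¹ ^ 2 + b⁻¹ ^ 2) := by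
    simp only [div_eq_mul_inv, mul_inv, ← inv_pow]
    ring
  have hpos : 0 < (s - 1 : ℝ) * (a⁻¹ ^ 2 + b⁻¹ ^ 2) := mul_pos (by linarith) (by positivity)
  rw [asympVariance, hsquares]
  positivity

theorem isCentralRank_mul {m : ℕ} (hm : 1 ≤ m) (hms : m ≤ s) :
    IsCentralRank ((m : ℝ) / (s + 1)) (fun k => (s + 1) * k - 1) (fun k => k * m) atTop := by
  have hsize : Tendsto (fun k => (s + 1) * k - 1) atTop atTop :=
    (tendsto_sub_atTop_nat 1).comp (tendsto_id.const_mul_atTop' s.succ_pos)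
  refine ⟨hsize, ?_, ?_⟩
  · filter_upwards [eventually_ge_atTop 1] with k hk
    have hkm : k * m ≤ k * s := by gcongr
    exact ⟨Nat.mul_pos hk hm, by rw [add_mul, mul_comm s k]; omega⟩
  · refine ((tendsto_sqrt_natCast_atTop hsize).const_div_atTop ((m : ℝ) / (s + 1))).congr' ?_
    filter_upwards [eventually_ge_atTop 1] with k hk
    have hcast : (((s + 1) * k - 1 : ℕ) : ℝ) = (s + 1) * k - 1 := by
      rw [Nat.cast_sub (Nat.mul_pos s.succ_pos hk)]
      push_cast
      ring
    rw [hcast, Nat.cast_mul]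
    congr 1
    field_simp
    ring

theorem tendstoInDistribution_logRatioStat {Ω : Type*} [MeasurableSpace Ω] {P : Measure Ω}
    [IsProbabilityMeasure P] [IsProbabilityMeasure μ] {Y : ℕ → Ω → ℝ}
    (hlaw : ∀ i, HasLaw (Y i) μ P) (hindep : iIndepFun Y P) (hs : 1 ≤ s)
    (hFx : cdf μ x = 1 / ((s : ℝ) + 1)) (hFy : cdf μ y = (s : ℝ) / ((s : ℝ) + 1)) (hxy : x ≤ y)
    (hx : x ≠ 0) (hy : y ≠ 0) (hfx : HasDerivAt (cdf μ) d x) (hd : 0 < d)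
    (hfy : HasDerivAt (cdf μ) e y) (he : 0 < e) :
    TendstoInDistribution (fun k ω => logRatioStat s k x y fun i => Y i ω) atTop id (fun _ => P)
      (gaussianReal 0 (asympVariance s (x * d) (y * e)).toNNReal) := by
  have hlower : IsCentralRank (cdf μ x) (fun k => (s + 1) * k - 1) (fun k => k) atTop := by
    simpa [hFx] using isCentralRank_mul le_rfl hs
  have hupper : IsCentralRank (cdf μ y) (fun k => (s + 1) * k - 1) (fun k => k * s) atTop :=
    hFy ▸ isCentralRank_mul hs le_rfl
  rw [← variance_quantileInfluence_sub_eq_asympVariance hFx hFy hxy, ← smul_quantileInfluence,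
    ← smul_quantileInfluence]
  exact tendstoInDistribution_sqrt_mul_comp_orderStat_sub hlaw hindep hfx hd hfy he hlower hupper
    (by fun_prop) (hasFDerivAt_log_div hx hy)

end LogRatio

section Transfer

theorem tendstoInDistribution_of_forall_identDistrib {ι E Ω' : Type*} {Ω₁ Ω₂ : ι → Type*}
    [∀ i, MeasurableSpace (Ω₁ i)] [∀ i, MeasurableSpace (Ω₂ i)] [MeasurableSpace Ω']
    {P₁ : ∀ i, Measure (Ω₁ i)} {P₂ : ∀ i, Measure (Ω₂ i)} [∀ i, IsProbabilityMeasure (P₁ i)]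
    [∀ i, IsProbabilityMeasure (P₂ i)] {P' : Measure Ω'} [IsProbabilityMeasure P'] {l : Filter ι}
    [TopologicalSpace E] [MeasurableSpace E] [OpensMeasurableSpace E] {X₁ : ∀ i, Ω₁ i → E}
    {X₂ : ∀ i, Ω₂ i → E} {Z : Ω' → E} (h : TendstoInDistribution X₁ l Z P₁ P')
    (hident : ∀ i, IdentDistrib (X₁ i) (X₂ i) (P₁ i) (P₂ i)) :
    TendstoInDistribution X₂ l Z P₂ P' :=
  ⟨fun i => (hident i).aemeasurable_snd, h.aemeasurable_limit,
    h.tendsto.congr fun i => Subtype.ext (hident i).map_eq⟩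

theorem identDistrib_comp_initialSegment {Ω Ω' α β : Type*} [MeasurableSpace Ω]
    [MeasurableSpace Ω'] [MeasurableSpace α] [MeasurableSpace β] {P : Measure Ω}
    {P' : Measure Ω'} {μ : Measure α} {n : ℕ} {Y : ℕ → Ω' → α} {X : Fin n → Ω → α}
    (hYlaw : ∀ i, HasLaw (Y i) μ P') (hY : iIndepFun Y P') (hXlaw : ∀ i, HasLaw (X i) μ P)
    (hX : iIndepFun X P) {T : (Fin n → α) → β} (hT : Measurable T) :
    IdentDistrib (fun ω => T fun i => Y i ω) (fun ω => T fun i => X i ω) P' P :=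
  (IdentDistrib.pi (fun i : Fin n => (hYlaw i).identDistrib (hXlaw i))
    (hY.precomp Fin.val_injective) hX).comp hT

end Transfer

theorem theorem1
    (s : ℕ) (hs : 2 ≤ s)
    -- the law `μ` of the observed variable, with c.d.f. `F = cdf μ`
    (μ : Measure ℝ) [IsProbabilityMeasure μ]
    -- for every `k`, a sample of `n = (s + 1) k - 1` independent observations
    {Ω : ℕ → Type*} [∀ k, MeasurableSpace (Ω k)]
    (P : ∀ k, Measure (Ω k)) [∀ k, IsProbabilityMeasure (P k)]
    (X : ∀ k, Fin ((s + 1) * k - 1) → Ω k → ℝ)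
    (hlaw : ∀ k i, HasLaw (X k i) μ (P k))
    (hindep : ∀ k, iIndepFun (X k) (P k))
    -- the two theoretical quantiles, whose ratio has to have a logarithm
    (x y : ℝ)
    (hx : x = quantile μ (1 / ((s : ℝ) + 1)))
    (hy : y = quantile μ ((s : ℝ) / ((s : ℝ) + 1)))
    (hxy : 0 < y / x)
    -- `f = F'` exists at the two quantiles, and it is positive and finite there
    (f : ℝ → ℝ)
    (hfx : HasDerivAt (fun t => cdf μ t) (f x) x) (hfx_pos : 0 < f x)
    (hfy : HasDerivAt (fun t => cdf μ t) (f y) y) (hfy_pos : 0 < f y)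
    (a b : ℝ) (ha : a = x * f x) (hb : b = y * f y) :
    0 < asympVariance s a b ∧
    TendstoInDistribution
      (fun (k : ℕ) (ω : Ω k) => logRatioStat s k x y (fun i => X k i ω))
      atTop (id : ℝ → ℝ) P (gaussianReal 0 (asympVariance s a b).toNNReal) ∧
    HasDerivAt (fun p => Real.log (quantile μ p)) (1 / a) (1 / ((s : ℝ) + 1)) ∧
    HasDerivAt (fun p => Real.log (quantile μ p)) (1 / b) ((s : ℝ) / ((s : ℝ) + 1)) := by
  subst hx hy ha hb
  have hs' : (2 : ℝ) ≤ s := by exact_mod_cast hs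
  have hp : 0 < 1 / ((s : ℝ) + 1) ∧ 1 / ((s : ℝ) + 1) < 1 :=
    ⟨by positivity, by rw [div_lt_one] <;> linarith⟩
  have hq : 0 < (s : ℝ) / (s + 1) ∧ (s : ℝ) / (s + 1) < 1 :=
    ⟨by positivity, by rw [div_lt_one] <;> linarith⟩
  obtain ⟨hy0, hx0⟩ := div_ne_zero_iff.1 hxy.ne'
  have hFx := cdf_quantile hp.1 hp.2 hfx.continuousAt
  have hFy := cdf_quantile hq.1 hq.2 hfy.continuousAt
  have hle : quantile μ (1 / (s + 1)) ≤ quantile μ (s / (s + 1)) :=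
    ((monotone_cdf μ).reflect_lt (by rw [hFx, hFy]; gcongr; linarith)).le
  obtain ⟨Ω', _, P', Y, -, hY, hYindep, _⟩ := exists_iid ℕ μ
  have hlim := tendstoInDistribution_logRatioStat hY hYindep (by omega) hFx hFy hle hx0 hy0
    hfx hfx_pos hfy hfy_pos
  exact ⟨asympVariance_pos hs (mul_ne_zero hx0 hfx_pos.ne'),
    tendstoInDistribution_of_forall_identDistrib hlim fun k => identDistrib_comp_initialSegment
      hY hYindep (hlaw k) (hindep k) (measurable_logRatioStat s k _ _),
    hasDerivAt_log_quantile hp.1 hp.2 hfx_pos hfx hx0,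
    hasDerivAt_log_quantile hq.1 hq.2 hfy_pos hfy hy0⟩
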